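/- Let $\mathcal C$ be a regular Goursat category, that is, a regular category (finite limits, coequalisers of kernel pairs, regular epimorphisms stable under pullback) such that $RSR = SRS$ for any two effective equivalence relations $R$ and $S$ on the same object (effective meaning: being the kernel pair of some morphism). Let $\mathcal X$ be a (regular epi)-reflective subcategory of $\mathcal C$: the inclusion $U\colon \mathcal X\to\mathcal C$ is full and faithful and has a left adjoint $I\colon\mathcal C\to\mathcal X$ such that every component $\eta_A\colon A\to UI(A)$ of the unit is a regular epimorphism. An internal precategory in a category consists of objects and morphisms $p_1,p_2,m\colon P_2\to P_1$, $d_1,d_2\colon P_1\to P_0$, $s\colon P_0\to P_1$ such that $d_1s=1_{P_0}=d_2s$, $d_2p_1=d_1p_2$, $d_1p_1=d_1m$ and $d_2p_2=d_2m$. It is an internal groupoid if $(P_2,p_1,p_2)$ is the pullback of $d_2$ along $d_1$, the composition $m$ is associative and has the identities $s$ as two-sided units, and there is a morphism $i\colon P_1\to P_1$ with $d_1i=d_2$, $d_2i=d_1$ that gives two-sided inverses for this composition. Let $f\colon A\to B$ be a regular epimorphism in $\mathcal C$, with kernel pair $d_1,d_2\colon \mathrm{Eq}(f)\to A$, and consider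 the internal groupoid $\mathrm{Eq}(f)\times_A\mathrm{Eq}(f)\rightrightarrows \mathrm{Eq}(f)\rightrightarrows A$ given by this equivalence relation, where in generalised elements $s(a)=(a,a)$, $p_1((a,b),(b,c))=(a,b)$, $p_2((a,b),(b,c))=(b,c)$ and $m((a,b),(b,c))=(a,c)$. Its image under $I$ is an internal precategory in $\mathcal X$, the internal Galois pregroupoid $\mathsf{Gal}(f)$: $$I(\mathrm{Eq}(f)\times_A\mathrm{Eq}(f)) \rightrightarrows I(\mathrm{Eq}(f)) \rightrightarrows I(A),$$ with structure morphisms $I(p_1),I(p_2),I(m),I(d_1),I(d_2),I(s)$. Then $\mathsf{Gal}(f)$ is an internal groupoid in $\mathcal X$. -/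

import Mathlib

open CategoryTheory CategoryTheory.Limits

universe v₁ v₂ u₁ u₂

section Relations

variable {C : Type u₁} [Category.{v₁} C] [Regular C]

/-- A relation from `X` to `Y` is a subobject of `X ⨯ Y`; this is its first leg `R ⟶ X`. -/
noncomputable def relFst {X Y : C} (R : Subobject (X ⨯ Y)) : (R : C) ⟶ X :=
  R.arrow ≫ prod.fst

/-- The second leg `R ⟶ Y` of a relation from `X` to `Y`. -/
noncomputable def relSnd {X Y : C} (R : Subobject (X ⨯ Y)) : (R : C) ⟶ Y :=
  R.arrow ≫ prod.snd

/-- The composite of a relation `R` from `X` to `Y` and a relation `S` from `Y` to `Z`, read from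
left to right: the image in `X ⨯ Z` of the pullback `R ×_Y S`. In generalized elements,
`x (RS) z` iff locally (for regular epimorphisms) there is `y` with `x R y` and `y S z`. -/
noncomputable def relComp {X Y Z : C} (R : Subobject (X ⨯ Y)) (S : Subobject (Y ⨯ Z)) :
    Subobject (X ⨯ Z) :=
  Subobject.mk (image.ι (prod.lift
    (pullback.fst (relSnd R) (relFst S) ≫ relFst R)
    (pullback.snd (relSnd R) (relFst S) ≫ relSnd S)))

variable (C) in
/-- A regular category is a Goursat category when the composition of effective equivalence
relations on a same object is 3-permutable: `RSR = SRS`. -/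
class IsGoursat : Prop where
  three_permutable : ∀ {X : C} (R S : Subobject (X ⨯ X)),
    IsEffectiveEquivalenceRelation (relFst R) (relSnd R) →
    IsEffectiveEquivalenceRelation (relFst S) (relSnd S) →
    relComp (relComp R S) R = relComp (relComp S R) S

end Relations

/-- An internal precategory: the diagram `P₂ ⇶ P₁ ⇉ P₀` underlying an internal category, without
any reference to pullbacks. Here `d₁` is the domain, `d₂` the codomain, `s` the identities, and an
element of `P₂` is thought of as a composable pair, with first arrow given by `p₁`, second arrow
given by `p₂`, and composite given by `m`. -/
structure InternalPrecategory (D : Type u₁) [Category.{v₁} D] where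
  P₀ : D
  P₁ : D
  P₂ : D
  d₁ : P₁ ⟶ P₀
  d₂ : P₁ ⟶ P₀
  s : P₀ ⟶ P₁
  p₁ : P₂ ⟶ P₁
  p₂ : P₂ ⟶ P₁
  m : P₂ ⟶ P₁
  s_d₁ : s ≫ d₁ = 𝟙 P₀
  s_d₂ : s ≫ d₂ = 𝟙 P₀
  p₁_d₂ : p₁ ≫ d₂ = p₂ ≫ d₁
  m_d₁ : m ≫ d₁ = p₁ ≫ d₁
  m_d₂ : m ≫ d₂ = p₂ ≫ d₂

namespace InternalPrecategory

/-- The image of an internal precategory under a functor. -/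
def map {C : Type u₁} [Category.{v₁} C] {D : Type u₂} [Category.{v₂} D]
    (P : InternalPrecategory C) (F : C ⥤ D) : InternalPrecategory D where
  P₀ := F.obj P.P₀
  P₁ := F.obj P.P₁
  P₂ := F.obj P.P₂
  d₁ := F.map P.d₁
  d₂ := F.map P.d₂
  s := F.map P.s
  p₁ := F.map P.p₁
  p₂ := F.map P.p₂
  m := F.map P.m
  s_d₁ := by rw [← F.map_comp, P.s_d₁, F.map_id]
  s_d₂ := by rw [← F.map_comp, P.s_d₂, F.map_id]
  p₁_d₂ := by rw [← F.map_comp, ← F.map_comp, P.p₁_d₂]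
  m_d₁ := by rw [← F.map_comp, ← F.map_comp, P.m_d₁]
  m_d₂ := by rw [← F.map_comp, ← F.map_comp, P.m_d₂]

variable {D : Type u₁} [Category.{v₁} D] (P : InternalPrecategory D)

/-- When `P₂` is the object of composable pairs, the composite "first `a`, then `b`" of two
composable generalized elements of `P₁`. -/
noncomputable def comp (h : IsPullback P.p₁ P.p₂ P.d₂ P.d₁) {T : D} (a b : T ⟶ P.P₁)
    (w : a ≫ P.d₂ = b ≫ P.d₁) : T ⟶ P.P₁ :=
  h.lift a b w ≫ P.m

lemma comp_d₁ (h : IsPullback P.p₁ P.p₂ P.d₂ P.d₁) {T : D} (a b : T ⟶ P.P₁)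
    (w : a ≫ P.d₂ = b ≫ P.d₁) : P.comp h a b w ≫ P.d₁ = a ≫ P.d₁ := by
  rw [comp, Category.assoc, P.m_d₁, h.lift_fst_assoc]

lemma comp_d₂ (h : IsPullback P.p₁ P.p₂ P.d₂ P.d₁) {T : D} (a b : T ⟶ P.P₁)
    (w : a ≫ P.d₂ = b ≫ P.d₁) : P.comp h a b w ≫ P.d₂ = b ≫ P.d₂ := by
  rw [comp, Category.assoc, P.m_d₂, h.lift_snd_assoc]

/-- An internal precategory is an internal category when `P₂` is the pullback of the codomain
`d₂` along the domain `d₁`, and the composition is unital and associative. -/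
structure IsInternalCategory : Prop where
  isPullback : IsPullback P.p₁ P.p₂ P.d₂ P.d₁
  id_comp : P.comp isPullback (P.d₁ ≫ P.s) (𝟙 P.P₁)
    (by rw [Category.assoc, P.s_d₂, Category.comp_id, Category.id_comp]) = 𝟙 P.P₁
  comp_id : P.comp isPullback (𝟙 P.P₁) (P.d₂ ≫ P.s)
    (by rw [Category.assoc, P.s_d₁, Category.comp_id, Category.id_comp]) = 𝟙 P.P₁
  assoc : ∀ {T : D} (a b c : T ⟶ P.P₁) (hab : a ≫ P.d₂ = b ≫ P.d₁) (hbc : b ≫ P.d₂ = c ≫ P.d₁),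
    P.comp isPullback (P.comp isPullback a b hab) c
        ((P.comp_d₂ isPullback a b hab).trans hbc) =
      P.comp isPullback a (P.comp isPullback b c hbc)
        (hab.trans (P.comp_d₁ isPullback b c hbc).symm)

/-- An internal precategory is an internal groupoid when it is an internal category and there is
an inversion morphism `i : P₁ ⟶ P₁`, giving two-sided inverses for the composition. -/
structure IsInternalGroupoid : Prop extends P.IsInternalCategory where
  exists_inv : ∃ (i : P.P₁ ⟶ P.P₁) (hi₁ : i ≫ P.d₁ = P.d₂) (hi₂ : i ≫ P.d₂ = P.d₁),
    P.comp isPullback (𝟙 P.P₁) i (by rw [Category.id_comp, hi₁]) = P.d₁ ≫ P.s ∧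
    P.comp isPullback i (𝟙 P.P₁) (by rw [Category.id_comp, hi₂]) = P.d₂ ≫ P.s

end InternalPrecategory

/-- The diagram `Eq(f) ×_A Eq(f) ⇶ Eq(f) ⇉ A` of the equivalence relation given by the kernel pair
of `f : A ⟶ B`. In generalized elements, `s a = (a, a)` and `m ((a, b), (b, c)) = (a, c)`. -/
noncomputable def kernelPairPrecategory {C : Type u₁} [Category.{v₁} C] [HasPullbacks C]
    {A B : C} (f : A ⟶ B) : InternalPrecategory C where
  P₀ := A
  P₁ := pullback f f
  P₂ := pullback (pullback.snd f f) (pullback.fst f f)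
  d₁ := pullback.fst f f
  d₂ := pullback.snd f f
  s := pullback.lift (𝟙 A) (𝟙 A) rfl
  p₁ := pullback.fst (pullback.snd f f) (pullback.fst f f)
  p₂ := pullback.snd (pullback.snd f f) (pullback.fst f f)
  m := pullback.lift
    (pullback.fst (pullback.snd f f) (pullback.fst f f) ≫ pullback.fst f f)
    (pullback.snd (pullback.snd f f) (pullback.fst f f) ≫ pullback.snd f f)
    (by rw [Category.assoc, Category.assoc, pullback.condition, ← pullback.condition (f := f),
          ← Category.assoc, ← Category.assoc, ← pullback.condition (f := pullback.snd f f),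
          Category.assoc, Category.assoc, pullback.condition])
  s_d₁ := pullback.lift_fst _ _ _
  s_d₂ := pullback.lift_snd _ _ _
  p₁_d₂ := pullback.condition
  m_d₁ := pullback.lift_fst _ _ _
  m_d₂ := pullback.lift_snd _ _ _

/-- The internal Galois pregroupoid `Gal(f)`: the image under the reflector `I` of the kernel pair
groupoid of `f`. -/
noncomputable def galoisPregroupoid {C : Type u₁} [Category.{v₁} C] [HasPullbacks C]
    {X : Type u₂} [Category.{v₂} X] (I : C ⥤ X) {A B : C} (f : A ⟶ B) : InternalPrecategory X :=
  (kernelPairPrecategory f).map I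

/-! The objects of composable pairs and triples in `Eq(f)` are pullbacks of a split epimorphism
along a split epimorphism, and the reflector `I` preserves such pullbacks. The groupoid axioms
involve only these pullbacks and equations between morphisms, so they carry over from `Eq(f)` to its
image (`IsInternalGroupoid.map`).

Preservation (`isPullback_map_reflector`) uses the unit, which is a levelwise regular epimorphism
from the square to its image under `UI`, compatible with the sections. In a Goursat category such a
quotient of a pullback is a pullback (`isPullback_of_isGoursat`): 3-permutability turns a zigzag of
the form `RSR` through the sections into one of the form `SRS`, so that preimages along the quotient
can be corrected until they agree where needed. -/

lemma CategoryTheory.Subobject.mk_factors_iff_exists {C : Type u₁} [Category.{v₁} C] {X Y Z : C}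
    (f : Y ⟶ X) [Mono f] (g : Z ⟶ X) :
    (Subobject.mk f).Factors g ↔ ∃ t : Z ⟶ Y, t ≫ f = g :=
  Iff.rfl

/-! ### Generalized elements of relations, and kernel pairs in a regular category -/

section RegularCategory

variable {C : Type u₁} [Category.{v₁} C] [Regular C]

/-- In a regular category, a generalized element of the codomain of a strong epimorphism lifts
along a strong epimorphism. -/
lemma exists_lift_of_strongEpi {X Y T : C} (q : X ⟶ Y) [StrongEpi q] (t : T ⟶ Y) :
    ∃ (T' : C) (e : T' ⟶ T) (_ : StrongEpi e) (x : T' ⟶ X), x ≫ q = e ≫ t :=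
  ⟨_, pullback.snd q t, inferInstance, pullback.fst q t, pullback.condition⟩

lemma prod_lift_relFst_relSnd {X Y T : C} (R : Subobject (X ⨯ Y)) (t : T ⟶ (R : C)) :
    prod.lift (t ≫ relFst R) (t ≫ relSnd R) = t ≫ R.arrow := by
  ext <;> simp [relFst, relSnd, prod.lift_fst, prod.lift_snd]

lemma factorThru_relFst {X Y T : C} (R : Subobject (X ⨯ Y)) {x : T ⟶ X} {y : T ⟶ Y}
    (h : R.Factors (prod.lift x y)) : R.factorThru _ h ≫ relFst R = x := by
  simp [relFst, prod.lift_fst]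

lemma factorThru_relSnd {X Y T : C} (R : Subobject (X ⨯ Y)) {x : T ⟶ X} {y : T ⟶ Y}
    (h : R.Factors (prod.lift x y)) : R.factorThru _ h ≫ relSnd R = y := by
  simp [relSnd, prod.lift_snd]

lemma factors_relFst_relSnd {X Y T : C} (R : Subobject (X ⨯ Y)) (t : T ⟶ (R : C)) :
    R.Factors (prod.lift (t ≫ relFst R) (t ≫ relSnd R)) := by
  rw [prod_lift_relFst_relSnd]
  exact Subobject.factors_comp_arrow t

/-- Generalized elements of a composite relation. -/
lemma relComp_factors_iff {X Y Z T : C} (R : Subobject (X ⨯ Y)) (S : Subobject (Y ⨯ Z))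
    (x : T ⟶ X) (z : T ⟶ Z) :
    (relComp R S).Factors (prod.lift x z) ↔
      ∃ (T' : C) (e : T' ⟶ T) (_ : StrongEpi e) (y : T' ⟶ Y),
        R.Factors (prod.lift (e ≫ x) y) ∧ S.Factors (prod.lift y (e ≫ z)) := by
  rw [relComp, Subobject.mk_factors_iff_exists]
  constructor
  · rintro ⟨t, ht⟩
    obtain ⟨T', e, he, w, hw⟩ := exists_lift_of_strongEpi (factorThruImage (prod.lift
      (pullback.fst (relSnd R) (relFst S) ≫ relFst R)
      (pullback.snd (relSnd R) (relFst S) ≫ relSnd S))) t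
    have hw' : w ≫ prod.lift
        (pullback.fst (relSnd R) (relFst S) ≫ relFst R)
        (pullback.snd (relSnd R) (relFst S) ≫ relSnd S) = e ≫ prod.lift x z := by
      rw [← image.fac (prod.lift _ _), reassoc_of% hw, ht]
    have h₁ := congrArg (· ≫ prod.fst) hw'
    have h₂ := congrArg (· ≫ prod.snd) hw'
    simp only [Category.assoc, prod.lift_fst, prod.lift_snd] at h₁ h₂
    refine ⟨T', e, he, w ≫ pullback.fst _ _ ≫ relSnd R, ?_, ?_⟩
    · rw [← h₁]
      simpa using factors_relFst_relSnd R (w ≫ pullback.fst (relSnd R) (relFst S))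
    · rw [← h₂, pullback.condition]
      simpa using factors_relFst_relSnd S (w ≫ pullback.snd (relSnd R) (relFst S))
  · rintro ⟨T', e, he, y, hR, hS⟩
    have w : R.factorThru _ hR ≫ relSnd R = S.factorThru _ hS ≫ relFst S := by
      rw [factorThru_relSnd, factorThru_relFst]
    have sq : CommSq (pullback.lift _ _ w ≫ factorThruImage (prod.lift
        (pullback.fst (relSnd R) (relFst S) ≫ relFst R)
        (pullback.snd (relSnd R) (relFst S) ≫ relSnd S))) e (image.ι _) (prod.lift x z) :=
      ⟨by
        rw [Category.assoc, image.fac, prod.comp_lift, prod.comp_lift, pullback.lift_fst_assoc,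
          pullback.lift_snd_assoc, factorThru_relFst, factorThru_relSnd]⟩
    -- Membership in a subobject is local for strong epimorphisms: `e` is orthogonal to the mono
    -- `image.ι`.
    exact ⟨sq.lift, sq.fac_right⟩

/-- The kernel pair of a morphism, as a relation. -/
noncomputable def kernelRel {X Y : C} (g : X ⟶ Y) : Subobject (X ⨯ X) :=
  haveI : Mono (prod.lift (pullback.fst g g) (pullback.snd g g)) := ⟨fun a b h => by
    have h₁ := congrArg (· ≫ prod.fst) h
    have h₂ := congrArg (· ≫ prod.snd) h
    simp only [Category.assoc, prod.lift_fst, prod.lift_snd] at h₁ h₂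
    exact pullback.hom_ext h₁ h₂⟩
  Subobject.mk (prod.lift (pullback.fst g g) (pullback.snd g g))

lemma kernelRel_factors_iff {X Y T : C} (g : X ⟶ Y) (x y : T ⟶ X) :
    (kernelRel g).Factors (prod.lift x y) ↔ x ≫ g = y ≫ g := by
  rw [kernelRel, Subobject.mk_factors_iff_exists]
  constructor
  · rintro ⟨t, ht⟩
    have h₁ := congrArg (· ≫ prod.fst) ht
    have h₂ := congrArg (· ≫ prod.snd) ht
    simp only [Category.assoc, prod.lift_fst,
      prod.lift_snd] at h₁ h₂
    rw [← h₁, ← h₂, Category.assoc, Category.assoc, pullback.condition]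
  · intro h
    exact ⟨pullback.lift x y h, by rw [prod.comp_lift, pullback.lift_fst, pullback.lift_snd]⟩

lemma isKernelPair_kernelRel {X Y : C} (g : X ⟶ Y) :
    IsKernelPair g (relFst (kernelRel g)) (relSnd (kernelRel g)) := by
  refine ⟨⟨?_⟩, ⟨PullbackCone.IsLimit.mk _
    (fun s => (kernelRel g).factorThru _ ((kernelRel_factors_iff g s.fst s.snd).2 s.condition))
    (fun s => factorThru_relFst _ _) (fun s => factorThru_relSnd _ _) fun s m h₁ h₂ => ?_⟩⟩
  · rw [← kernelRel_factors_iff]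
    simpa using factors_relFst_relSnd (kernelRel g) (𝟙 _)
  · rw [← cancel_mono (kernelRel g).arrow, ← prod_lift_relFst_relSnd, h₁, h₂,
      Subobject.factorThru_arrow]

lemma isEffectiveEquivalenceRelation_kernelRel {X Y : C} (g : X ⟶ Y) :
    IsEffectiveEquivalenceRelation (relFst (kernelRel g)) (relSnd (kernelRel g)) := by
  have h := isKernelPair_kernelRel g
  -- An effective equivalence relation needs a quotient map, which `g` need not be. Its image
  -- factorisation has the same kernel pair, and `F.e` is a regular epimorphism.
  let F := Regular.strongEpiMonoFactorisation g
  have hF : F.e ≫ F.m = g := F.fac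
  have h' : IsKernelPair F.e (relFst (kernelRel g)) (relSnd (kernelRel g)) :=
    IsKernelPair.cancel_right_of_mono (f₂ := F.m) (by rwa [hF])
  have : IsRegularEpi F.e := inferInstanceAs
    (IsRegularEpi (Regular.strongEpiMonoFactorisation g).e)
  -- Precomposing with the diagonal, a common section of the two legs, shows that a pushout cocone
  -- on them is just a cofork.
  have hs' (s : PushoutCocone (relFst (kernelRel g)) (relSnd (kernelRel g))) :
      s.inl = s.inr := by
    have := h.lift (𝟙 X) (𝟙 X) rfl ≫= s.condition
    rwa [h.lift_fst_assoc, h.lift_snd_assoc, Category.id_comp, Category.id_comp] at this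
  have hs (s : PushoutCocone (relFst (kernelRel g)) (relSnd (kernelRel g))) :
      relFst (kernelRel g) ≫ s.inl = relSnd (kernelRel g) ≫ s.inl := by
    rw [s.condition, hs']
  exact ⟨⟨{
    toEquivalenceRelation := IsKernelPair.equivalenceRelation g _ _ (pullback.isLimit _ _) h
    B := F.I
    π := F.e
    isKernelPair := h'
    isPushout := ⟨⟨h'.w⟩, ⟨PushoutCocone.IsColimit.mk _
      (fun s => Cofork.IsColimit.desc h'.toCoequalizer' s.inl (hs s))
      (fun s => Cofork.IsColimit.π_desc' h'.toCoequalizer' _ (hs s))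
      (fun s => (Cofork.IsColimit.π_desc' h'.toCoequalizer' _ (hs s)).trans (hs' s))
      fun s m h₁ _ => Cofork.IsColimit.hom_ext h'.toCoequalizer'
        (h₁.trans (Cofork.IsColimit.π_desc' h'.toCoequalizer' _ (hs s)).symm)⟩⟩ }⟩⟩

/-- Three-permutability of kernel pairs, in terms of generalized elements. -/
lemma IsGoursat.exists_of_kernel_zigzag [IsGoursat C] {X Y Z T : C} (g : X ⟶ Y) (h : X ⟶ Z)
    {x u v y : T ⟶ X} (hxu : x ≫ g = u ≫ g) (huv : u ≫ h = v ≫ h) (hvy : v ≫ g = y ≫ g) :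
    ∃ (T' : C) (e : T' ⟶ T) (_ : StrongEpi e) (u' v' : T' ⟶ X),
      e ≫ x ≫ h = u' ≫ h ∧ u' ≫ g = v' ≫ g ∧ v' ≫ h = e ≫ y ≫ h := by
  have key : (relComp (relComp (kernelRel g) (kernelRel h)) (kernelRel g)).Factors
      (prod.lift x y) := by
    rw [relComp_factors_iff]
    refine ⟨T, 𝟙 T, inferInstance, v, ?_, ?_⟩
    · rw [relComp_factors_iff]
      refine ⟨T, 𝟙 T, inferInstance, u, ?_, ?_⟩ <;> rw [kernelRel_factors_iff] <;> simpa
    · rw [kernelRel_factors_iff]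
      simpa
  rw [IsGoursat.three_permutable _ _ (isEffectiveEquivalenceRelation_kernelRel g)
    (isEffectiveEquivalenceRelation_kernelRel h), relComp_factors_iff] at key
  obtain ⟨T₁, e₁, he₁, v', h₁, h₂⟩ := key
  rw [relComp_factors_iff] at h₁
  obtain ⟨T₂, e₂, he₂, u', h₃, h₄⟩ := h₁
  rw [kernelRel_factors_iff] at h₂ h₃ h₄
  refine ⟨T₂, e₂ ≫ e₁, inferInstance, u', e₂ ≫ v', by simpa using h₃, h₄, ?_⟩
  simpa using congrArg (e₂ ≫ ·) h₂

end RegularCategory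

/-! ### Quotients of pullbacks of split epimorphisms -/

section QuotientPullback

variable {C : Type u₁} [Category.{v₁} C]

/-- A commutative square of split epimorphisms with chosen sections. When it is a pullback, `iA` is
`x ↦ (x, sB (a x))` and `iB` is `y ↦ (sA (b y), y)`. -/
structure SplitSquare (C : Type u₁) [Category.{v₁} C] where
  D : C
  A : C
  B : C
  K : C
  pA : D ⟶ A
  pB : D ⟶ B
  a : A ⟶ K
  b : B ⟶ K
  sA : K ⟶ A
  sB : K ⟶ B
  iA : A ⟶ D
  iB : B ⟶ D
  w : pA ≫ a = pB ≫ b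
  sA_a : sA ≫ a = 𝟙 K
  sB_b : sB ≫ b = 𝟙 K
  iA_pA : iA ≫ pA = 𝟙 A
  iA_pB : iA ≫ pB = a ≫ sB
  iB_pA : iB ≫ pA = b ≫ sA
  iB_pB : iB ≫ pB = 𝟙 B

namespace SplitSquare

/-- The image of a square of split epimorphisms under a functor. -/
def map (S : SplitSquare C) {E : Type u₂} [Category.{v₂} E] (F : C ⥤ E) : SplitSquare E where
  D := F.obj S.D
  A := F.obj S.A
  B := F.obj S.B
  K := F.obj S.K
  pA := F.map S.pA
  pB := F.map S.pB
  a := F.map S.a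
  b := F.map S.b
  sA := F.map S.sA
  sB := F.map S.sB
  iA := F.map S.iA
  iB := F.map S.iB
  w := by simp only [← F.map_comp, S.w]
  sA_a := by simp only [← F.map_comp, S.sA_a, F.map_id]
  sB_b := by simp only [← F.map_comp, S.sB_b, F.map_id]
  iA_pA := by simp only [← F.map_comp, S.iA_pA, F.map_id]
  iA_pB := by simp only [← F.map_comp, S.iA_pB]
  iB_pA := by simp only [← F.map_comp, S.iB_pA]
  iB_pB := by simp only [← F.map_comp, S.iB_pB, F.map_id]

/-- The square of split epimorphisms obtained by pulling back a split epimorphism along another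
one. -/
noncomputable def ofIsPullback {D A B K : C} {pA : D ⟶ A} {pB : D ⟶ B} {a : A ⟶ K} {b : B ⟶ K}
    (h : IsPullback pA pB a b) (sA : K ⟶ A) (sB : K ⟶ B) (hA : sA ≫ a = 𝟙 K)
    (hB : sB ≫ b = 𝟙 K) : SplitSquare C where
  D := D
  A := A
  B := B
  K := K
  pA := pA
  pB := pB
  a := a
  b := b
  sA := sA
  sB := sB
  iA := h.lift (𝟙 A) (a ≫ sB) (by rw [Category.id_comp, Category.assoc, hB, Category.comp_id])
  iB := h.lift (b ≫ sA) (𝟙 B) (by rw [Category.id_comp, Category.assoc, hA, Category.comp_id])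
  w := h.w
  sA_a := hA
  sB_b := hB
  iA_pA := h.lift_fst _ _ _
  iA_pB := h.lift_snd _ _ _
  iB_pA := h.lift_fst _ _ _
  iB_pB := h.lift_snd _ _ _

/-- Morphisms of squares of split epimorphisms, compatible with the sections. -/
structure Hom (S S' : SplitSquare C) where
  q : S.D ⟶ S'.D
  qA : S.A ⟶ S'.A
  qB : S.B ⟶ S'.B
  qK : S.K ⟶ S'.K
  pA : q ≫ S'.pA = S.pA ≫ qA
  pB : q ≫ S'.pB = S.pB ≫ qB
  a : qA ≫ S'.a = S.a ≫ qK
  b : qB ≫ S'.b = S.b ≫ qK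
  sA : qK ≫ S'.sA = S.sA ≫ qA
  sB : qK ≫ S'.sB = S.sB ≫ qB
  iA : qA ≫ S'.iA = S.iA ≫ q
  iB : qB ≫ S'.iB = S.iB ≫ q

/-- A natural transformation induces a morphism between the images of a square. -/
def homOfNatTrans (S : SplitSquare C) {E : Type u₂} [Category.{v₂} E] {F G : C ⥤ E} (η : F ⟶ G) :
    Hom (S.map F) (S.map G) where
  q := η.app S.D
  qA := η.app S.A
  qB := η.app S.B
  qK := η.app S.K
  pA := (η.naturality _).symm
  pB := (η.naturality _).symm
  a := (η.naturality _).symm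
  b := (η.naturality _).symm
  sA := (η.naturality _).symm
  sB := (η.naturality _).symm
  iA := (η.naturality _).symm
  iB := (η.naturality _).symm

variable [Regular C] [IsGoursat C] {S S' : SplitSquare C} (φ : Hom S S')

/-- Preimages of `x` and `y` in `S.D` are corrected twice, without changing their images under
`φ.q`: first to agree in `S.A`, then also in `S.B`. They then coincide because `S.D` is a pullback.
-/
lemma hom_ext_of_isGoursat (h : IsPullback S.pA S.pB S.a S.b) [StrongEpi φ.q] {T : C}
    {x y : T ⟶ S'.D} (hA : x ≫ S'.pA = y ≫ S'.pA) (hB : x ≫ S'.pB = y ≫ S'.pB) : x = y := by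
  obtain ⟨T₁, e₁, he₁, x₁, hx₁⟩ := exists_lift_of_strongEpi φ.q x
  obtain ⟨T₂, e₂, he₂, y₂, hy₂⟩ := exists_lift_of_strongEpi φ.q (e₁ ≫ y)
  obtain ⟨T₃, e₃, he₃, x₃, y₃, h₁, h₂, h₃⟩ := IsGoursat.exists_of_kernel_zigzag S.pA φ.q
    (x := e₂ ≫ x₁) (u := e₂ ≫ x₁ ≫ S.pA ≫ S.iA) (v := y₂ ≫ S.pA ≫ S.iA) (y := y₂)
    (by simp [S.iA_pA])
    (by
      simp only [Category.assoc, ← φ.iA]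
      rw [← reassoc_of% φ.pA, reassoc_of% hx₁, reassoc_of% hy₂, reassoc_of% hA])
    (by simp [S.iA_pA])
  have hx₃ : x₃ ≫ φ.q = e₃ ≫ e₂ ≫ e₁ ≫ x := by rw [← h₁, Category.assoc, hx₁]
  have hy₃ : y₃ ≫ φ.q = e₃ ≫ e₂ ≫ e₁ ≫ y := by rw [h₃, hy₂]
  -- The kernel pair of `(S.pA, φ.q)` is `Eq(pA) ∩ Eq(q)`, so this second correction keeps the
  -- agreement in `S.A` obtained from the first.
  obtain ⟨T₄, e₄, he₄, m, n, h₄, h₅, h₆⟩ := IsGoursat.exists_of_kernel_zigzag S.pB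
    (prod.lift S.pA φ.q) (x := x₃) (u := x₃ ≫ S.pB ≫ S.iB) (v := y₃ ≫ S.pB ≫ S.iB) (y := y₃)
    (by simp [S.iB_pB])
    (by
      simp only [prod.comp_lift, Category.assoc, S.iB_pA, ← φ.iB]
      rw [← reassoc_of% S.w, reassoc_of% h₂, ← reassoc_of% φ.pB, reassoc_of% hx₃, reassoc_of% hy₃,
        reassoc_of% hB])
    (by simp [S.iB_pB])
  have h₄A := congrArg (· ≫ prod.fst) h₄
  have h₄q := congrArg (· ≫ prod.snd) h₄
  have h₆A := congrArg (· ≫ prod.fst) h₆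
  have h₆q := congrArg (· ≫ prod.snd) h₆
  simp only [Category.assoc, prod.lift_fst, prod.lift_snd] at h₄A h₄q h₆A h₆q
  have hmn : m = n := h.hom_ext (by rw [← h₄A, h₆A, h₂]) h₅
  rw [← cancel_epi (e₄ ≫ e₃ ≫ e₂ ≫ e₁)]
  simp only [Category.assoc]
  rw [← hx₃, ← hy₃, h₄q, hmn, h₆q]

/-- Preimages of `x` and `y` need not agree over `S.K`. Embedded in `S.D` by the sections, they are
joined by a zigzag for `Eq(pA ≫ a)` and `Eq(q)`; permuting it gives `u` and `v` over the same
element of `S.K`, with unchanged images under `φ.q`. The pair `(pA u, pB v)` is then an element of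
`S.D`. -/
lemma exists_lift_of_isGoursat (h : IsPullback S.pA S.pB S.a S.b) [StrongEpi φ.qA]
    [StrongEpi φ.qB] {T : C} (x : T ⟶ S'.A) (y : T ⟶ S'.B) (w : x ≫ S'.a = y ≫ S'.b) :
    ∃ (T' : C) (e : T' ⟶ T) (_ : StrongEpi e) (z : T' ⟶ S'.D),
      z ≫ S'.pA = e ≫ x ∧ z ≫ S'.pB = e ≫ y := by
  obtain ⟨T₁, e₁, he₁, x₁, hx₁⟩ := exists_lift_of_strongEpi φ.qA x
  obtain ⟨T₂, e₂, he₂, y₂, hy₂⟩ := exists_lift_of_strongEpi φ.qB (e₁ ≫ y)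
  obtain ⟨T₃, e₃, he₃, u, v, h₁, h₂, h₃⟩ := IsGoursat.exists_of_kernel_zigzag (S.pA ≫ S.a) φ.q
    (x := e₂ ≫ x₁ ≫ S.iA) (u := e₂ ≫ x₁ ≫ S.a ≫ S.sA ≫ S.iA) (v := y₂ ≫ S.b ≫ S.sA ≫ S.iA)
    (y := y₂ ≫ S.iB)
    (by simp [reassoc_of% S.iA_pA, S.sA_a])
    (by
      simp only [Category.assoc, ← φ.iA]
      rw [← reassoc_of% φ.sA, ← reassoc_of% φ.a, ← reassoc_of% φ.b, reassoc_of% hx₁,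
        reassoc_of% hy₂, reassoc_of% w])
    (by simp [reassoc_of% S.iA_pA, S.sA_a, reassoc_of% S.iB_pA])
  have hz : (u ≫ S.pA) ≫ S.a = (v ≫ S.pB) ≫ S.b := by
    simpa [S.w] using h₂
  refine ⟨T₃, e₃ ≫ e₂ ≫ e₁, inferInstance, h.lift _ _ hz ≫ φ.q, ?_, ?_⟩
  · rw [Category.assoc, φ.pA, h.lift_fst_assoc, Category.assoc, ← φ.pA, ← reassoc_of% h₁, φ.pA,
      reassoc_of% S.iA_pA, hx₁]
    simp
  · rw [Category.assoc, φ.pB, h.lift_snd_assoc, Category.assoc, ← φ.pB, reassoc_of% h₃, φ.pB,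
      reassoc_of% S.iB_pB, hy₂]
    simp

/-- In a regular Goursat category, a levelwise quotient of a pullback of a split epimorphism along
a split epimorphism, compatible with the sections, is again a pullback. -/
theorem isPullback_of_isGoursat (h : IsPullback S.pA S.pB S.a S.b) [StrongEpi φ.q]
    [StrongEpi φ.qA] [StrongEpi φ.qB] : IsPullback S'.pA S'.pB S'.a S'.b := by
  let c : S'.D ⟶ pullback S'.a S'.b := pullback.lift S'.pA S'.pB S'.w
  have hcA : c ≫ pullback.fst _ _ = S'.pA := pullback.lift_fst _ _ _
  have hcB : c ≫ pullback.snd _ _ = S'.pB := pullback.lift_snd _ _ _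
  have : Mono c := ⟨fun x y hxy => hom_ext_of_isGoursat φ h
    (by rw [← hcA, reassoc_of% hxy]) (by rw [← hcB, reassoc_of% hxy])⟩
  -- Lifting the universal compatible pair locally makes the comparison `c` a strong epimorphism.
  obtain ⟨T, e, he, z, hA, hB⟩ := exists_lift_of_isGoursat φ h
    (pullback.fst S'.a S'.b) (pullback.snd S'.a S'.b) pullback.condition
  have hz : z ≫ c = e := pullback.hom_ext (by rw [Category.assoc, hcA, hA])
    (by rw [Category.assoc, hcB, hB])
  have : StrongEpi (z ≫ c) := hz ▸ he
  have : StrongEpi c := strongEpi_of_strongEpi z c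
  have : IsIso c := isIso_of_mono_of_strongEpi c
  exact IsPullback.of_iso_pullback ⟨S'.w⟩ (asIso c) hcA hcB

end SplitSquare

end QuotientPullback

/-- A (regular epi)-reflector on a regular Goursat category preserves pullbacks of split
epimorphisms along split epimorphisms. -/
theorem isPullback_map_reflector {C : Type u₁} [Category.{v₁} C] [Regular C] [IsGoursat C]
    {X : Type u₂} [Category.{v₂} X] {I : C ⥤ X} {U : X ⥤ C} (adj : I ⊣ U) [U.Full] [U.Faithful]
    (unit_regularEpi : ∀ A : C, IsRegularEpi (adj.unit.app A))
    {D A B K : C} {pA : D ⟶ A} {pB : D ⟶ B} {a : A ⟶ K} {b : B ⟶ K}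
    (h : IsPullback pA pB a b) (sA : K ⟶ A) (sB : K ⟶ B) (hA : sA ≫ a = 𝟙 K)
    (hB : sB ≫ b = 𝟙 K) : IsPullback (I.map pA) (I.map pB) (I.map a) (I.map b) := by
  have hunit (A : C) : StrongEpi (adj.unit.app A) := by
    have := unit_regularEpi A
    infer_instance
  let S := SplitSquare.ofIsPullback h sA sB hA hB
  let φ := S.homOfNatTrans adj.unit
  have : StrongEpi φ.q := hunit D
  have : StrongEpi φ.qA := hunit A
  have : StrongEpi φ.qB := hunit B
  have key : IsPullback (U.map (I.map pA)) (U.map (I.map pB)) (U.map (I.map a))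
      (U.map (I.map b)) := SplitSquare.isPullback_of_isGoursat φ h
  -- Being fully faithful, `U` reflects pullbacks.
  exact IsPullback.of_map U (by rw [← I.map_comp, ← I.map_comp, h.w]) key

/-! ### Transport of internal groupoids along functors -/

namespace InternalPrecategory

section Comp

variable {D : Type u₁} [Category.{v₁} D] (P : InternalPrecategory D)

lemma comp_eq (h : IsPullback P.p₁ P.p₂ P.d₂ P.d₁) {T : D} (t : T ⟶ P.P₂) {a b : T ⟶ P.P₁}
    (w : a ≫ P.d₂ = b ≫ P.d₁) (ha : t ≫ P.p₁ = a) (hb : t ≫ P.p₂ = b) :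
    P.comp h a b w = t ≫ P.m := by
  have : h.lift a b w = t := h.hom_ext (by rw [h.lift_fst, ha]) (by rw [h.lift_snd, hb])
  rw [comp, this]

lemma precomp_comp (h : IsPullback P.p₁ P.p₂ P.d₂ P.d₁) {S T : D} (t : S ⟶ T) (a b : T ⟶ P.P₁)
    (w : a ≫ P.d₂ = b ≫ P.d₁) (w' : (t ≫ a) ≫ P.d₂ = (t ≫ b) ≫ P.d₁) :
    P.comp h (t ≫ a) (t ≫ b) w' = t ≫ P.comp h a b w := by
  rw [P.comp_eq h (t ≫ h.lift a b w) w' (by rw [Category.assoc, h.lift_fst])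
    (by rw [Category.assoc, h.lift_snd]), comp, Category.assoc]

end Comp

section Map

variable {C : Type u₁} [Category.{v₁} C] {D : Type u₂} [Category.{v₂} D]
  (P : InternalPrecategory C) (F : C ⥤ D)

lemma map_comp_eq (h : IsPullback P.p₁ P.p₂ P.d₂ P.d₁)
    (h' : IsPullback (P.map F).p₁ (P.map F).p₂ (P.map F).d₂ (P.map F).d₁) {T : C}
    (a b : T ⟶ P.P₁) (w : a ≫ P.d₂ = b ≫ P.d₁) {a' b' : F.obj T ⟶ (P.map F).P₁}
    (w' : a' ≫ (P.map F).d₂ = b' ≫ (P.map F).d₁) (ha : F.map a = a') (hb : F.map b = b') :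
    (P.map F).comp h' a' b' w' = F.map (P.comp h a b w) := by
  rw [(P.map F).comp_eq h' (F.map (h.lift a b w)) w', comp, F.map_comp]
  · rfl
  · exact (F.map_comp _ _).symm.trans ((congrArg F.map (h.lift_fst a b w)).trans ha)
  · exact (F.map_comp _ _).symm.trans ((congrArg F.map (h.lift_snd a b w)).trans hb)

/-- A functor preserving the objects of composable pairs and of composable triples of an internal
groupoid sends it to an internal groupoid. -/
theorem IsInternalGroupoid.map {P : InternalPrecategory C} (hP : P.IsInternalGroupoid)
    (h₂ : IsPullback (F.map P.p₁) (F.map P.p₂) (F.map P.d₂) (F.map P.d₁))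
    {P₃ : C} {l : P₃ ⟶ P.P₂} {r : P₃ ⟶ P.P₁} (w₃ : l ≫ P.p₂ ≫ P.d₂ = r ≫ P.d₁)
    (h₃ : IsPullback (F.map l) (F.map r) (F.map (P.p₂ ≫ P.d₂)) (F.map P.d₁)) :
    (P.map F).IsInternalGroupoid where
  isPullback := h₂
  id_comp :=
    (P.map_comp_eq F hP.isPullback h₂ _ _ (by rw [Category.assoc, P.s_d₂, Category.comp_id, Category.id_comp]) _
      (F.map_comp _ _) (F.map_id _)).trans ((congrArg F.map hP.id_comp).trans (F.map_id _))
  comp_id :=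
    (P.map_comp_eq F hP.isPullback h₂ _ _ (by rw [Category.assoc, P.s_d₁, Category.comp_id, Category.id_comp]) _
      (F.map_id _) (F.map_comp _ _)).trans ((congrArg F.map hP.comp_id).trans (F.map_id _))
  assoc {T} a b c hab hbc := by
    obtain ⟨t, ht₁, ht₂⟩ : ∃ t : T ⟶ F.obj P.P₂, t ≫ F.map P.p₁ = a ∧ t ≫ F.map P.p₂ = b :=
      ⟨h₂.lift a b hab, h₂.lift_fst _ _ _, h₂.lift_snd _ _ _⟩
    -- `a`, `b`, `c` need not come from `C`, but by `h₂` and `h₃` they factor through the image of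
    -- the triple carried by `P₃`, to which associativity in `P` applies.
    obtain ⟨u, hu₁, hu₂⟩ : ∃ u : T ⟶ F.obj P₃, u ≫ F.map l = t ∧ u ≫ F.map r = c := by
      have w : t ≫ F.map (P.p₂ ≫ P.d₂) = c ≫ F.map P.d₁ := by
        rw [F.map_comp, reassoc_of% ht₂]
        exact hbc
      exact ⟨h₃.lift t c w, h₃.lift_fst _ _ _, h₃.lift_snd _ _ _⟩
    have ha : a = u ≫ F.map (l ≫ P.p₁) := by rw [F.map_comp, reassoc_of% hu₁, ht₁]
    have hb : b = u ≫ F.map (l ≫ P.p₂) := by rw [F.map_comp, reassoc_of% hu₁, ht₂]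
    subst ha hb hu₂
    have wab : (l ≫ P.p₁) ≫ P.d₂ = (l ≫ P.p₂) ≫ P.d₁ := by
      rw [Category.assoc, P.p₁_d₂, Category.assoc]
    have wbc : (l ≫ P.p₂) ≫ P.d₂ = r ≫ P.d₁ := by rw [Category.assoc, w₃]
    have comp_eq {x y : P₃ ⟶ P.P₁} (w : x ≫ P.d₂ = y ≫ P.d₁) {x' y' : T ⟶ F.obj P.P₁}
        (w' : x' ≫ F.map P.d₂ = y' ≫ F.map P.d₁) (hx : x' = u ≫ F.map x)
        (hy : y' = u ≫ F.map y) :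
        (P.map F).comp h₂ x' y' w' = u ≫ F.map (P.comp hP.isPullback x y w) := by
      subst hx hy
      have wF : F.map x ≫ F.map P.d₂ = F.map y ≫ F.map P.d₁ := by
        rw [← F.map_comp, w, F.map_comp]
      rw [← P.map_comp_eq F hP.isPullback h₂ x y w wF rfl rfl]
      exact (P.map F).precomp_comp h₂ u _ _ wF w'
    exact (comp_eq ((P.comp_d₂ hP.isPullback _ _ wab).trans wbc) _ (comp_eq wab _ rfl rfl)
      rfl).trans ((congrArg (u ≫ F.map ·) (hP.assoc _ _ _ wab wbc)).trans
        (comp_eq (wab.trans (P.comp_d₁ hP.isPullback _ _ wbc).symm) _ rfl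
          (comp_eq wbc _ rfl rfl)).symm)
  exists_inv := by
    obtain ⟨i, hi₁, hi₂, h, h'⟩ := hP.exists_inv
    refine ⟨F.map i, ?_, ?_, ?_, ?_⟩
    · exact (F.map_comp _ _).symm.trans (congrArg F.map hi₁)
    · exact (F.map_comp _ _).symm.trans (congrArg F.map hi₂)
    · exact (P.map_comp_eq F hP.isPullback h₂ _ _ (by rw [Category.id_comp, hi₁]) _
        (F.map_id _) rfl).trans ((congrArg F.map h).trans (F.map_comp _ _))
    · exact (P.map_comp_eq F hP.isPullback h₂ _ _ (by rw [Category.id_comp, hi₂]) _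
        rfl (F.map_id _)).trans ((congrArg F.map h').trans (F.map_comp _ _))

end Map

end InternalPrecategory

/-- An internal precategory whose domain and codomain morphisms are jointly monic is an internal
groupoid as soon as it has an object of composable pairs and an inversion. -/
lemma InternalPrecategory.isInternalGroupoid_of_hom_ext {C : Type u₁} [Category.{v₁} C]
    (P : InternalPrecategory C)
    (h : IsPullback P.p₁ P.p₂ P.d₂ P.d₁)
    (hom_ext : ∀ {T : C} {a b : T ⟶ P.P₁}, a ≫ P.d₁ = b ≫ P.d₁ → a ≫ P.d₂ = b ≫ P.d₂ → a = b)
    (i : P.P₁ ⟶ P.P₁) (hi₁ : i ≫ P.d₁ = P.d₂) (hi₂ : i ≫ P.d₂ = P.d₁) :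
    P.IsInternalGroupoid where
  isPullback := h
  id_comp := hom_ext (by simp [comp_d₁, P.s_d₁]) (by simp [comp_d₂])
  comp_id := hom_ext (by simp [comp_d₁]) (by simp [comp_d₂, P.s_d₂])
  assoc a b c hab hbc := hom_ext (by simp [comp_d₁]) (by simp [comp_d₂])
  exists_inv := ⟨i, hi₁, hi₂,
    hom_ext (by simp [comp_d₁, P.s_d₁]) (by simp [comp_d₂, P.s_d₂, hi₂]),
    hom_ext (by simp [comp_d₁, P.s_d₁, hi₁]) (by simp [comp_d₂, P.s_d₂])⟩

lemma isInternalGroupoid_kernelPairPrecategory {C : Type u₁} [Category.{v₁} C] [HasPullbacks C]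
    {A B : C} (f : A ⟶ B) : (kernelPairPrecategory f).IsInternalGroupoid :=
  InternalPrecategory.isInternalGroupoid_of_hom_ext _
    (IsPullback.of_hasPullback (pullback.snd f f) (pullback.fst f f))
    (fun h₁ h₂ => pullback.hom_ext h₁ h₂)
    (pullback.lift (pullback.snd f f) (pullback.fst f f) pullback.condition.symm)
    (pullback.lift_fst _ _ _) (pullback.lift_snd _ _ _)

theorem corollary2p3 {C : Type u₁} [Category.{v₁} C] [Regular C] [IsGoursat C]
    {X : Type u₂} [Category.{v₂} X] (I : C ⥤ X) (U : X ⥤ C) (adj : I ⊣ U) [U.Full] [U.Faithful]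
    (unit_regularEpi : ∀ A : C, IsRegularEpi (adj.unit.app A))
    {A B : C} (f : A ⟶ B) (hf : IsRegularEpi f) :
    (galoisPregroupoid I f).IsInternalGroupoid := by
  let P := kernelPairPrecategory f
  have hP : P.IsInternalGroupoid := isInternalGroupoid_kernelPairPrecategory f
  -- The pair of identities `a ↦ ((a, a), (a, a))` splits the codomain map of composable pairs, so
  -- the object of composable triples is also a pullback of split epimorphisms.
  let s₂ : P.P₀ ⟶ P.P₂ := hP.isPullback.lift P.s P.s (P.s_d₂.trans P.s_d₁.symm)
  have hs₂ : s₂ ≫ P.p₂ ≫ P.d₂ = 𝟙 P.P₀ := by rw [hP.isPullback.lift_snd_assoc, P.s_d₂]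
  exact hP.map I
    (isPullback_map_reflector adj unit_regularEpi hP.isPullback P.s P.s P.s_d₂ P.s_d₁)
    pullback.condition
    (isPullback_map_reflector adj unit_regularEpi
      (IsPullback.of_hasPullback (P.p₂ ≫ P.d₂) P.d₁) s₂ P.s hs₂ P.s_d₁)
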